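/- **Theorem 3.7.** For a function $f$ holomorphic near $\zeta\in\mathbb C$ write $a_v=f^{(v)}(\zeta)/v!$ for $v\ge 0$ and $a_i=0$ for $i<0$. For $p,q\in\{0,1,2,\dots\}$ write $f\in\mathcal D_{p,q}(\zeta)$ if the $q\times q$ Hankel determinant $\det\,(a_{p-q+1+i+j})_{0\le i,j\le q-1}$ is non-zero (for $q=0$ this always holds). In that case there is exactly one rational function of the form $$[p/q]_{f,\zeta}(z)=\frac{\sum_{v=0}^{p}n_v(z-\zeta)^v}{\sum_{v=0}^{q}d_v(z-\zeta)^v},\qquad d_0=1,$$ whose Taylor coefficients at $\zeta$ of index $0,1,\dots,p+q$ coincide with $a_0,a_1,\dots,a_{p+q}$; it is the Padé approximant of $f$ of type $(p,q)$ with centre $\zeta$. Let $\Omega\subseteq\mathbb C$ be a simply connected open set, i.e. an open set, not necessarily connected, each of whose connected components is simply connected (equivalently, $(\mathbb C\cup\{\infty\})\setminus\Omega$ is connected). Let $\mathcal F\subseteq\mathbb N\times\mathbb N$, where $0\in\mathbb N$, contain a sequence $(\tilde p_n,\tilde q_n)$, $n=1,2,\dots$, with $\tilde p_n\to+\infty$.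 Let $H(\Omega)$ be the space of holomorphic functions on $\Omega$ with the topology of uniform convergence on compact subsets of $\Omega$. Then there is a function $f\in H(\Omega)$ with the following property: there exists a sequence $(p_n,q_n)\in\mathcal F$, $n=1,2,\dots$, such that for every compact set $K\subseteq\Omega$ there is an $n(K)\in\mathbb N$ with $f\in\mathcal D_{p_n,q_n}(\zeta)$ for all $n\ge n(K)$ and all $\zeta\in K$, and $$\sup_{\zeta\in K}\,\sup_{z\in K}\bigl|[p_n/q_n]_{f,\zeta}(z)-f(z)\bigr|\longrightarrow 0\qquad(n\to+\infty),$$ where the absolute value is $+\infty$ if $z$ is a pole of $[p_n/q_n]_{f,\zeta}$. Moreover, the set of all $f\in H(\Omega)$ with this property is a dense $G_\delta$ subset of $H(\Omega)$. -/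

import Mathlib

open Filter Topology Polynomial
open scoped Nat ENNReal

/-- An open set `Ω ⊆ ℂ`, not necessarily connected, is simply connected if each of its connected
components is simply connected (equivalently, `(ℂ ∪ {∞}) \ Ω` is connected). For a connected
non-empty `Ω` this is the usual notion. -/
def IsSimplyConnectedOpen (Ω : Set ℂ) : Prop :=
  IsOpen Ω ∧ ∀ z ∈ Ω, IsSimplyConnected (connectedComponentIn Ω z)

/-- Extension by `0` to `ℂ` of a function on `Ω`, used to speak of complex derivatives at the
points of the open set `Ω`. -/
noncomputable def extendZero {Ω : Set ℂ} (f : Ω → ℂ) : ℂ → ℂ :=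
  Function.extend Subtype.val f 0

/-- The space `H(Ω)` of holomorphic functions on the open set `Ω`. It carries the topology induced
by the compact-open topology of `C(Ω, ℂ)`, i.e. that of uniform convergence on compact subsets. -/
abbrev HolomorphicFunctions (Ω : Set ℂ) : Type :=
  {f : C(Ω, ℂ) // DifferentiableOn ℂ (extendZero f) Ω}

/-- The coefficient `a_v = f^(v)(ζ) / v!` of the Taylor development of `f` around `ζ`. -/
noncomputable def taylorCoefficient (f : ℂ → ℂ) (ζ : ℂ) (v : ℕ) : ℂ :=
  iteratedDeriv v f ζ / (v ! : ℂ)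

/-- A sequence of coefficients, continued by `a_i = 0` for `i < 0`. -/
def extendCoefficients (a : ℕ → ℂ) (i : ℤ) : ℂ :=
  if i < 0 then 0 else a i.toNat

/-- The `q × q` Hankel matrix with entry `a_{p-q+1+i+j}` in row `i` and column `j`, for
`0 ≤ i, j < q`. -/
def hankelMatrix (a : ℕ → ℂ) (p q : ℕ) : Matrix (Fin q) (Fin q) ℂ :=
  Matrix.of fun i j => extendCoefficients a ((p : ℤ) - q + 1 + i + j)

/-- The condition that the Hankel determinant is non-zero (it is `1` for `q = 0`). -/
def HankelNondegenerate (a : ℕ → ℂ) (p q : ℕ) : Prop :=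
  (hankelMatrix a p q).det ≠ 0

/-- `R`, a rational function of `w = z - ζ`, is a `[p/q]` Padé approximant of the formal series
`∑ a_v w^v`: it is a quotient `N / D` with `deg N ≤ p`, `deg D ≤ q`, `D(0) = 1`, and its Taylor
series in `w` agrees with `∑ a_v w^v` in the coefficients of index `0, …, p + q`. -/
def IsPadeApproximant (a : ℕ → ℂ) (p q : ℕ) (R : RatFunc ℂ) : Prop :=
  ∃ N D : ℂ[X], N.natDegree ≤ p ∧ D.natDegree ≤ q ∧ D.coeff 0 = 1 ∧
    R = algebraMap ℂ[X] (RatFunc ℂ) N / algebraMap ℂ[X] (RatFunc ℂ) D ∧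
    ∀ v ≤ p + q, PowerSeries.coeff v ((N : PowerSeries ℂ) * (D : PowerSeries ℂ)⁻¹) = a v

open Classical in
/-- The Padé approximant `[p/q]` of the formal series `∑ a_v w^v`. It is the unique one when the
Hankel determinant is non-zero, see `existsUnique_isPadeApproximant`; the value `0` is a default
when there is none. -/
noncomputable def padeApproximant (a : ℕ → ℂ) (p q : ℕ) : RatFunc ℂ :=
  if h : ∃ R, IsPadeApproximant a p q R then h.choose else 0

theorem coeff_mul_mk_eq (a : ℕ → ℂ) (q n : ℕ) (D : ℂ[X]) (hD : D.natDegree ≤ q) :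
    PowerSeries.coeff n ((D : PowerSeries ℂ) * PowerSeries.mk a) =
      ∑ j ∈ Finset.range (q + 1), D.coeff j * extendCoefficients a ((n : ℤ) - j) := by
  rw [PowerSeries.coeff_mul, Finset.Nat.sum_antidiagonal_eq_sum_range_succ_mk]
  have h1 : ∑ k ∈ Finset.range n.succ, PowerSeries.coeff k (D : PowerSeries ℂ) *
      PowerSeries.coeff (n - k) (PowerSeries.mk a) =
      ∑ j ∈ Finset.range (n + 1), D.coeff j * extendCoefficients a ((n : ℤ) - j) := by
    refine Finset.sum_congr rfl fun k hk => ?_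
    have hk' : k ≤ n := Nat.lt_succ_iff.mp (Finset.mem_range.mp hk)
    have h2 : ¬ ((n : ℤ) - k < 0) := by omega
    have h3 : ((n : ℤ) - k).toNat = n - k := by omega
    simp [extendCoefficients, h2, h3]
  rw [h1]
  have h4 : ∀ m, n + 1 ≤ m → ∑ j ∈ Finset.range (n + 1), D.coeff j *
      extendCoefficients a ((n : ℤ) - j) =
      ∑ j ∈ Finset.range m, D.coeff j * extendCoefficients a ((n : ℤ) - j) := by
    intro m hm
    refine Finset.sum_subset (by simpa using hm) fun x _ hx => ?_
    have : (n : ℤ) - x < 0 := by simp at hx; omega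
    simp [extendCoefficients, this]
  have h5 : ∀ m, q + 1 ≤ m → ∑ j ∈ Finset.range (q + 1), D.coeff j *
      extendCoefficients a ((n : ℤ) - j) =
      ∑ j ∈ Finset.range m, D.coeff j * extendCoefficients a ((n : ℤ) - j) := by
    intro m hm
    refine Finset.sum_subset (by simpa using hm) fun x _ hx => ?_
    have : D.coeff x = 0 := Polynomial.coeff_eq_zero_of_natDegree_lt (by simp at hx; omega)
    simp [this]
  rw [h4 (n + q + 1) (by omega), h5 (n + q + 1) (by omega)]

theorem coeff_mul_mk_eq_hankel (a : ℕ → ℂ) (p q : ℕ) (D : ℂ[X]) (hD : D.natDegree ≤ q)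
    (h0 : D.coeff 0 = 1) (i : Fin q) :
    PowerSeries.coeff (p + 1 + i) ((D : PowerSeries ℂ) * PowerSeries.mk a) =
      a (p + 1 + i) + (hankelMatrix a p q).mulVec (fun j => D.coeff (q - j)) i := by
  rw [coeff_mul_mk_eq a q _ D hD, Finset.sum_range_succ', h0, add_comm]
  congr 1
  · have h2 : ¬ (((p + 1 + i : ℕ) : ℤ) < 0) := by omega
    simp only [Nat.cast_zero, sub_zero, one_mul, extendCoefficients, h2, if_false, Int.toNat_natCast]
  · rw [← Finset.sum_range_reflect, Matrix.mulVec, dotProduct, Finset.sum_range]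
    refine Finset.sum_congr rfl fun j _ => ?_
    have hj := j.2
    have h3 : q - 1 - (j : ℕ) + 1 = q - j := by omega
    have h4 : ((p + 1 + i : ℕ) : ℤ) - ((q - j : ℕ) : ℤ) = (p : ℤ) - q + 1 + i + j := by omega
    rw [h3, h4, hankelMatrix, Matrix.of_apply, mul_comm]

theorem coeff_mul_inv_eq_iff (a : ℕ → ℂ) (m : ℕ) (N D : ℂ[X]) (h0 : D.coeff 0 = 1) :
    (∀ v ≤ m, PowerSeries.coeff v ((N : PowerSeries ℂ) * (D : PowerSeries ℂ)⁻¹) = a v) ↔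
      ∀ v ≤ m, N.coeff v = PowerSeries.coeff v ((D : PowerSeries ℂ) * PowerSeries.mk a) := by
  have hc : PowerSeries.constantCoeff (D : PowerSeries ℂ) ≠ 0 := by simp [h0]
  have e1 : (N : PowerSeries ℂ) = (D : PowerSeries ℂ) * (N * (D : PowerSeries ℂ)⁻¹) := by
    rw [mul_left_comm, PowerSeries.mul_inv_cancel _ hc, mul_one]
  have e2 : PowerSeries.mk a =
      (D : PowerSeries ℂ)⁻¹ * ((D : PowerSeries ℂ) * PowerSeries.mk a) := by
    rw [← mul_assoc, PowerSeries.inv_mul_cancel _ hc, one_mul]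
  have key : ∀ (B F G : PowerSeries ℂ),
      (∀ v ≤ m, PowerSeries.coeff v F = PowerSeries.coeff v G) →
      ∀ v ≤ m, PowerSeries.coeff v (B * F) = PowerSeries.coeff v (B * G) := by
    intro B F G h v hv
    rw [PowerSeries.coeff_mul, PowerSeries.coeff_mul]
    refine Finset.sum_congr rfl fun x hx => ?_
    rw [h x.2 (by have := Finset.HasAntidiagonal.mem_antidiagonal.mp hx; omega)]
  constructor
  · intro h v hv
    rw [← Polynomial.coeff_coe N, e1]
    exact key _ _ _ (fun w hw => by rw [h w hw, PowerSeries.coeff_mk]) v hv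
  · intro h v hv
    rw [mul_comm, ← PowerSeries.coeff_mk v a, e2]
    exact key _ _ _ (fun w hw => by rw [Polynomial.coeff_coe, h w hw]) v hv

/-- If the Hankel determinant is non-zero, there is exactly one Padé approximant. -/
theorem existsUnique_isPadeApproximant (a : ℕ → ℂ) (p q : ℕ) (h : HankelNondegenerate a p q) :
    ∃! R, IsPadeApproximant a p q R := by
  have hu : IsUnit (hankelMatrix a p q) :=
    (Matrix.isUnit_iff_isUnit_det _).mpr (isUnit_iff_ne_zero.mpr h)
  refine existsUnique_of_exists_of_unique ?_ ?_
  · obtain ⟨x, hx⟩ := (Matrix.mulVec_surjective_iff_isUnit.mpr hu)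
      (fun i : Fin q => - a (p + 1 + i))
    set D : ℂ[X] := ∑ k ∈ Finset.range (q + 1), Polynomial.monomial k
      (if k = 0 then 1 else if hk : q - k < q then x ⟨q - k, hk⟩ else 0) with hDdef
    have hco : ∀ k ≤ q, D.coeff k =
        if k = 0 then 1 else if hk : q - k < q then x ⟨q - k, hk⟩ else 0 := by
      intro k hk
      rw [hDdef, Polynomial.finsetSum_coeff]
      simp only [Polynomial.coeff_monomial]
      rw [Finset.sum_ite_eq' (Finset.range (q + 1)) k, if_pos (by simp; omega)]
    have hdeg : D.natDegree ≤ q :=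
      Polynomial.natDegree_sum_le_of_forall_le _ _ fun k hk =>
        (Polynomial.natDegree_monomial_le _).trans (by simp at hk; omega)
    have h0 : D.coeff 0 = 1 := by rw [hco 0 (Nat.zero_le _)]; simp
    have hv : (fun j : Fin q => D.coeff (q - j)) = x := by
      funext j
      have hj := j.2
      have e : q - (q - (j : ℕ)) = j := by omega
      rw [hco _ (Nat.sub_le _ _), if_neg (by omega), dif_pos (by omega)]
      exact congrArg x (Fin.ext e)
    refine ⟨_, PowerSeries.trunc (p + 1) ((D : PowerSeries ℂ) * PowerSeries.mk a), D,
      ?_, hdeg, h0, rfl, ?_⟩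
    · exact Nat.lt_succ_iff.mp (PowerSeries.natDegree_trunc_lt _ _)
    · rw [coeff_mul_inv_eq_iff a _ _ D h0]
      intro v hvm
      rw [PowerSeries.coeff_trunc]
      split_ifs with hlt
      · rfl
      · have := coeff_mul_mk_eq_hankel a p q D hdeg h0 ⟨v - (p + 1), by omega⟩
        rw [hv, hx] at this
        simp only [add_neg_cancel] at this
        rw [← this]
        congr 2
        omega
  · rintro R R' ⟨N, D, hN, hD, h0, rfl, hT⟩ ⟨N', D', hN', hD', h0', rfl, hT'⟩
    rw [coeff_mul_inv_eq_iff _ _ _ _ h0] at hT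
    rw [coeff_mul_inv_eq_iff _ _ _ _ h0'] at hT'
    have sol : ∀ (M E : ℂ[X]), M.natDegree ≤ p → E.natDegree ≤ q → E.coeff 0 = 1 →
        (∀ v ≤ p + q, M.coeff v = PowerSeries.coeff v ((E : PowerSeries ℂ) * PowerSeries.mk a)) →
        (hankelMatrix a p q).mulVec (fun j => E.coeff (q - j)) =
          fun i : Fin q => - a (p + 1 + i) := by
      intro M E hM hE hE0 hME
      funext i
      have hi := i.2
      have e := coeff_mul_mk_eq_hankel a p q E hE hE0 i
      rw [← hME _ (by omega), Polynomial.coeff_eq_zero_of_natDegree_lt (by omega)] at e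
      exact eq_neg_of_add_eq_zero_right e.symm
    have hvec := (Matrix.mulVec_injective_iff_isUnit.mpr hu)
      ((sol N D hN hD h0 hT).trans (sol N' D' hN' hD' h0' hT').symm)
    have hDD : D = D' := by
      ext k
      rcases Nat.eq_zero_or_pos k with rfl | hk
      · rw [h0, h0']
      · by_cases hkq : k ≤ q
        · have := congrFun hvec ⟨q - k, by omega⟩
          simpa [Nat.sub_sub_self hkq] using this
        · rw [Polynomial.coeff_eq_zero_of_natDegree_lt (by omega),
            Polynomial.coeff_eq_zero_of_natDegree_lt (by omega)]
    subst hDD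
    have hNN : N = N' := by
      ext k
      by_cases hkp : k ≤ p
      · rw [hT k (by omega), hT' k (by omega)]
      · rw [Polynomial.coeff_eq_zero_of_natDegree_lt (by omega),
          Polynomial.coeff_eq_zero_of_natDegree_lt (by omega)]
    rw [hNN]

/-- The condition `f ∈ 𝓓_{p,q}(ζ)` for a holomorphic function `f` on `Ω` and `ζ ∈ Ω`. -/
def MemD {Ω : Set ℂ} (f : HolomorphicFunctions Ω) (p q : ℕ) (ζ : ℂ) : Prop :=
  HankelNondegenerate (taylorCoefficient (extendZero f.1) ζ) p q

open Classical in
/-- The distance `|[p/q]_{f,ζ}(z) - f(z)|`, which is `∞` if `z` is a pole of `[p/q]_{f,ζ}`. -/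
noncomputable def padeError {Ω : Set ℂ} (f : HolomorphicFunctions Ω) (p q : ℕ) (ζ z : ℂ) : ℝ≥0∞ :=
  let R := padeApproximant (taylorCoefficient (extendZero f.1) ζ) p q
  if R.denom.eval (z - ζ) = 0 then ⊤
  else ‖RatFunc.eval (RingHom.id ℂ) (z - ζ) R - extendZero f.1 z‖ₑ

/-- The holomorphic functions `f` on `Ω` for which one sequence `(p_n, q_n)` in `F` is such that
for every compact `K ⊆ Ω`: for all large `n`, `f ∈ 𝓓_{p_n,q_n}(ζ)` for all `ζ ∈ K`; and
`sup_{ζ ∈ K} sup_{z ∈ K} |[p_n/q_n]_{f,ζ}(z) - f(z)| → 0`. -/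
def padeApproximableFunctions (Ω : Set ℂ) (F : Set (ℕ × ℕ)) : Set (HolomorphicFunctions Ω) :=
  {f | ∃ u : ℕ → ℕ × ℕ, (∀ n, u n ∈ F) ∧ ∀ K : Set ℂ, IsCompact K → K ⊆ Ω →
    (∃ n₀ : ℕ, ∀ n ≥ n₀, ∀ ζ ∈ K, MemD f (u n).1 (u n).2 ζ) ∧
    Tendsto (fun n => ⨆ ζ ∈ K, ⨆ z ∈ K, padeError f (u n).1 (u n).2 ζ z) atTop (𝓝 0)}

/-! The proof is a Baire category argument. Exhaust Ω by compact sets E_m and consider the functions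
that, for some (p, q) in F, have a non-zero Hankel determinant at every centre in E_m and a Padé
error below 1/(m+1) on E_m. The functions sought are those that satisfy this for every m
(`padeApproximableFunctions_eq_iInter`), so it suffices that each of these sets is open and dense in
the Baire space H(Ω).

Openness (`isOpen_padeCloseFunctions`): where the Hankel determinant is non-zero, numerator and
denominator are explicit continuous functions of finitely many Taylor coefficients, which in turn
depend continuously on function and centre jointly; compactness of E_m × E_m makes the conditions
uniform.

Density (`dense_iUnion_padeCloseFunctions`): a polynomial of exact degree p is its own [p/q]
approximant at every centre, for every q. Polynomials are dense by Runge's theorem, and a small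
multiple of z^p raises the degree to a large p with (p, q) in F.

Runge's theorem rests on the Cauchy-Pompeiu formula, which writes a holomorphic function as a
superposition of kernels 1/(w - z) with w outside a compact set L ⊇ K. Here L consists of K and the
poles whose kernel is not a uniform limit of polynomials on K; L \ K is open, so simple connectivity
forces L ⊆ Ω. -/

/-! ### The Cauchy-Pompeiu formula and superpositions of Cauchy kernels -/

open MeasureTheory in
/-- The **Cauchy-Pompeiu formula** for a compactly supported function, at the origin. -/
theorem integral_dbar_div_self {h : ℂ → ℂ} (hh : ContDiff ℝ 1 h) (hc : HasCompactSupport h) :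
    ∫ w, (fderiv ℝ h w 1 + Complex.I * fderiv ℝ h w Complex.I) / w = -(2 * Real.pi) * h 0 := by
  have hd : Differentiable ℝ h := hh.differentiable one_ne_zero
  have hfc : Continuous (fderiv ℝ h) := hh.continuous_fderiv one_ne_zero
  obtain ⟨R, hR, hKR⟩ := hc.isCompact.isBounded.subset_ball_lt 0 0
  have hzero : ∀ w : ℂ, R ≤ ‖w‖ → h w = 0 := fun w hw =>
    image_eq_zero_of_notMem_tsupport fun hw' => by
      have := hKR hw'
      rw [mem_ball_zero_iff] at this
      linarith
  have hDzero : ∀ w : ℂ, R ≤ ‖w‖ → fderiv ℝ h w = 0 := fun w hw =>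
    image_eq_zero_of_notMem_tsupport fun hw' => by
      have := hKR (tsupport_fderiv_subset ℝ hw')
      rw [mem_ball_zero_iff] at this
      linarith
  set e : ℝ → ℂ := fun θ => Complex.exp (θ * Complex.I) with he
  have hec : Continuous e := by simp only [he]; fun_prop
  have hne : ∀ θ, ‖e θ‖ = 1 := fun θ => Complex.norm_exp_ofReal_mul_I θ
  have hed : ∀ θ, HasDerivAt e (Complex.I * e θ) θ := fun θ => by
    have h1 : HasDerivAt (fun t : ℝ => (t : ℂ) * Complex.I) Complex.I θ := by
      simpa using (Complex.ofRealCLM.hasDerivAt (x := θ)).mul_const Complex.I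
    simpa [he, mul_comm] using h1.cexp
  -- `A` is the radial derivative of `h`, and `B` the angular one divided by `r`. The polar Jacobian
  -- cancels the modulus of `1 / w`, and the integrand becomes `A + I * B`.
  set A : ℝ × ℝ → ℂ := fun p => fderiv ℝ h (p.1 * e p.2) (e p.2) with hA
  set B : ℝ × ℝ → ℂ := fun p => fderiv ℝ h (p.1 * e p.2) (Complex.I * e p.2) with hB
  have hAc : Continuous A := by
    refine (hfc.comp ?_).clm_apply ?_ <;> fun_prop
  have hBc : Continuous B := by
    refine (hfc.comp ?_).clm_apply ?_ <;> fun_prop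
  have hint : ∀ C : ℝ × ℝ → ℂ, Continuous C → (∀ p, R ≤ p.1 → C p = 0) →
      IntegrableOn C (Set.Ioi 0 ×ˢ Set.Ioo (-Real.pi) Real.pi) := by
    intro C hC hC0
    have h1 : IntegrableOn C (Set.Icc 0 R ×ˢ Set.Icc (-Real.pi) Real.pi) :=
      hC.continuousOn.integrableOn_compact (isCompact_Icc.prod isCompact_Icc)
    refine (h1.of_forall_sdiff_eq_zero (s := Set.Icc 0 R ×ˢ Set.Icc (-Real.pi) Real.pi)
      (t := (Set.Ioi 0 ×ˢ Set.Ioo (-Real.pi) Real.pi) ) ?_ ?_)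
    · exact measurableSet_Ioi.prod measurableSet_Ioo
    · rintro ⟨r, θ⟩ ⟨⟨hr, hθ⟩, hn⟩
      refine hC0 _ ?_
      by_contra hlt
      exact hn ⟨⟨le_of_lt hr, (not_le.mp hlt).le⟩, ⟨hθ.1.le, hθ.2.le⟩⟩
  have hnr : ∀ p : ℝ × ℝ, R ≤ p.1 → R ≤ ‖(p.1 : ℂ) * e p.2‖ := by
    intro p hp
    rw [norm_mul, hne, mul_one, Complex.norm_real]
    exact hp.trans (le_abs_self _)
  have hAi := hint A hAc fun p hp => by simp [hA, hDzero _ (hnr p hp)]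
  have hBi := hint B hBc fun p hp => by simp [hB, hDzero _ (hnr p hp)]
  -- Each ray contributes `-h 0` to `A`, since `h` vanishes far out; each circle contributes zero to
  -- `B`, by periodicity.
  have hIA : ∫ p in Set.Ioi 0 ×ˢ Set.Ioo (-Real.pi) Real.pi, A p = -(2 * Real.pi) * h 0 := by
    rw [Measure.volume_eq_prod, ← Measure.prod_restrict, integral_prod_symm]
    · have h1 : ∀ θ, ∫ r in Set.Ioi (0 : ℝ), A (r, θ) = - h 0 := by
        intro θ
        have := integral_Ioi_of_hasDerivAt_of_tendsto (a := (0 : ℝ)) (m := 0)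
          (f := fun r : ℝ => h (r * e θ)) (f' := fun r : ℝ => A (r, θ)) ?_ ?_ ?_ ?_
        · simpa using this
        · refine Continuous.continuousWithinAt ?_
          have := hd.continuous
          fun_prop
        · intro r _
          have h2 : HasDerivAt (fun r : ℝ => (r : ℂ) * e θ) (e θ) r := by
            simpa using (Complex.ofRealCLM.hasDerivAt (x := r)).mul_const (e θ)
          exact (hd _).hasFDerivAt.comp_hasDerivAt r h2
        · have h3 : IntegrableOn (fun r : ℝ => A (r, θ)) (Set.Icc 0 R) :=
            (hAc.comp (by fun_prop : Continuous fun r : ℝ => (r, θ))).continuousOn.integrableOn_compact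
              isCompact_Icc
          refine h3.of_forall_sdiff_eq_zero measurableSet_Ioi ?_
          rintro r ⟨hr, hn⟩
          have : R ≤ r := by
            by_contra hlt
            exact hn ⟨le_of_lt hr, (not_le.mp hlt).le⟩
          simp [hA, hDzero _ (hnr (r, θ) this)]
        · refine tendsto_const_nhds.congr' ?_
          filter_upwards [eventually_ge_atTop R] with r hr
          exact (hzero _ (hnr (r, θ) hr)).symm
      simp only [h1]
      rw [setIntegral_const]
      simp only [measureReal_def, Real.volume_Ioo]
      rw [ENNReal.toReal_ofReal (by linarith [Real.pi_pos]), Complex.real_smul]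
      push_cast
      ring
    · rw [Measure.prod_restrict, ← Measure.volume_eq_prod]
      exact hAi
  have hIB : ∫ p in Set.Ioi 0 ×ˢ Set.Ioo (-Real.pi) Real.pi, B p = 0 := by
    rw [Measure.volume_eq_prod, setIntegral_prod _ hBi]
    refine setIntegral_eq_zero_of_forall_eq_zero fun r hr => ?_
    have hr0 : (r : ℂ) ≠ 0 := by exact_mod_cast (ne_of_gt hr)
    rw [← integral_Ioc_eq_integral_Ioo, ← intervalIntegral.integral_of_le (by linarith [Real.pi_pos])]
    have h1 : ∫ θ in (-Real.pi)..Real.pi, (r : ℂ) * B (r, θ) = 0 := by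
      rw [intervalIntegral.integral_eq_sub_of_hasDerivAt (f := fun θ : ℝ => h (r * e θ))]
      · simp [he, Complex.exp_pi_mul_I, neg_mul, Complex.exp_neg]
      · intro θ _
        have h2 : HasDerivAt (fun θ : ℝ => (r : ℂ) * e θ) (r * (Complex.I * e θ)) θ :=
          (hed θ).const_mul _
        have h3 := (hd _).hasFDerivAt.comp_hasDerivAt θ h2
        have h4 : (r : ℂ) * (Complex.I * e θ) = r • (Complex.I * e θ) := (Complex.real_smul).symm
        rw [h4, map_smul, Complex.real_smul] at h3
        exact h3
      · refine Continuous.intervalIntegrable ?_ _ _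
        fun_prop
    rw [intervalIntegral.integral_const_mul] at h1
    exact (mul_eq_zero.mp h1).resolve_left hr0
  rw [← Complex.integral_comp_polarCoord_symm, polarCoord_target]
  have hcongr : ∀ p ∈ Set.Ioi (0 : ℝ) ×ˢ Set.Ioo (-Real.pi) Real.pi,
      p.1 • ((fderiv ℝ h (Complex.polarCoord.symm p) 1 + Complex.I *
        fderiv ℝ h (Complex.polarCoord.symm p) Complex.I) / Complex.polarCoord.symm p) =
      A p + Complex.I * B p := by
    rintro ⟨r, θ⟩ ⟨hr, -⟩
    have hr0 : (r : ℂ) ≠ 0 := by exact_mod_cast (ne_of_gt hr)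
    have hpe : Complex.polarCoord.symm (r, θ) = r * e θ := by
      simp [he, Complex.exp_mul_I]
    have hlin : ∀ (L : ℂ →L[ℝ] ℂ) (z : ℂ), L z = z.re * L 1 + z.im * L Complex.I := by
      intro L z
      conv_lhs => rw [← Complex.re_add_im z, ← mul_one (z.re : ℂ), ← Complex.real_smul,
        ← Complex.real_smul, map_add, map_smul, map_smul, Complex.real_smul, Complex.real_smul]
    have he0 : e θ ≠ 0 := Complex.exp_ne_zero _
    rw [hpe, Complex.real_smul]
    simp only [hA, hB]
    rw [hlin _ (e θ), hlin _ (Complex.I * e θ)]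
    generalize fderiv ℝ h (r * e θ) 1 = X
    generalize fderiv ℝ h (r * e θ) Complex.I = Y
    have hre : (e θ).re = Real.cos θ := by simp [he, Complex.exp_ofReal_mul_I_re]
    have him : (e θ).im = Real.sin θ := by simp [he, Complex.exp_ofReal_mul_I_im]
    have hee : e θ = Complex.cos θ + Complex.sin θ * Complex.I := Complex.exp_mul_I _
    simp only [Complex.mul_re, Complex.mul_im, hre, him, Complex.I_re, Complex.I_im]
    push_cast
    rw [mul_div_assoc', mul_div_mul_left _ _ hr0, div_eq_iff he0, hee]
    have := Complex.sin_sq_add_cos_sq (θ : ℂ)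
    have hI : Complex.I ^ 2 = -1 := Complex.I_sq
    generalize Complex.cos θ = c at *
    generalize Complex.sin θ = s at *
    linear_combination (-(X + Complex.I * Y)) * this +
      (s ^ 2 * X - Y * s * c) * hI
  rw [setIntegral_congr_fun (measurableSet_Ioi.prod measurableSet_Ioo) hcongr,
    integral_add hAi (hBi.const_mul _), integral_const_mul, hIA, hIB]
  simp

open MeasureTheory in
/-- The **Cauchy-Pompeiu formula** for a compactly supported function. -/
theorem integral_dbar_div_sub {g : ℂ → ℂ} (hg : ContDiff ℝ 1 g) (hc : HasCompactSupport g) (z : ℂ) :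
    ∫ w, (fderiv ℝ g w 1 + Complex.I * fderiv ℝ g w Complex.I) / (w - z) =
      -(2 * Real.pi) * g z := by
  have h1 := integral_dbar_div_self (h := fun w => g (w + z)) (hg.comp (by fun_prop))
    (hc.comp_homeomorph (Homeomorph.addRight z))
  simp only [fderiv_comp_add_right, zero_add] at h1
  rw [← h1, ← integral_add_right_eq_self _ z]
  simp

/-- A Bochner integral lies in every closed submodule that contains the values of the integrand. -/
theorem Submodule.integral_mem_of_isClosed {X E : Type*} [MeasurableSpace X]
    {μ : MeasureTheory.Measure X} [NormedAddCommGroup E] [NormedSpace ℝ E] [NormedSpace ℂ E]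
    [CompleteSpace E] (S : Submodule ℂ E) (hS : IsClosed (S : Set E)) {G : X → E}
    (hG : MeasureTheory.Integrable G μ) (hGS : ∀ x, G x ∈ S) : ∫ x, G x ∂μ ∈ S := by
  have : IsClosed (S : Set E) := hS
  -- The continuous quotient map by `S` commutes with the integral and kills the integrand.
  have h1 := S.mkQL.integral_comp_comm hG
  have h2 : ∀ x, S.mkQL (G x) = 0 := fun x => (Submodule.Quotient.mk_eq_zero S).mpr (hGS x)
  simp only [h2, MeasureTheory.integral_zero] at h1
  exact (Submodule.Quotient.mk_eq_zero S).mp h1.symm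

/-- If `f` is holomorphic on a neighbourhood `Ω` of the compact set `L ⊇ K`, then `f` belongs on `K`
to every closed subspace of `C(K, ℂ)` that contains the functions `z ↦ 1 / (w - z)`, `w ∉ L`. -/
theorem mem_of_forall_inv_sub_mem {K L Ω : Set ℂ} [CompactSpace K] (hKL : K ⊆ L) (hL : IsCompact L)
    (hΩ : IsOpen Ω) (hLΩ : L ⊆ Ω) {f : ℂ → ℂ} (hf : DifferentiableOn ℂ f Ω)
    (S : Submodule ℂ C(K, ℂ)) (hS : IsClosed (S : Set C(K, ℂ)))
    (hker : ∀ w ∉ L, ∀ c : C(K, ℂ), (∀ z, c z = (w - z)⁻¹) → c ∈ S)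
    (F : C(K, ℂ)) (hF : ∀ z, F z = f z) : F ∈ S := by
  obtain ⟨T, hT, hLT, hTΩ⟩ := exists_compact_between hL hΩ hLΩ
  obtain ⟨χ, hχ1, hχ0, -⟩ := exists_contMDiffMap_one_nhds_of_subset_interior
    (modelWithCornersSelf ℝ ℂ) hL.isClosed hLT
  have hχc : ContDiff ℝ 1 χ := (χ.contMDiff.contDiff).of_le (by exact_mod_cast le_top)
  have hχT : tsupport χ ⊆ T := closure_minimal (fun x hx => by
    by_contra h
    exact hx (hχ0 x h)) hT.isClosed
  set g : ℂ → ℂ := fun w => (χ w : ℂ) * f w with hg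
  have hgT : tsupport g ⊆ T := closure_minimal (fun x hx => by
    by_contra h
    exact hx (by simp [hg, hχ0 x h])) hT.isClosed
  have hgc : HasCompactSupport g := hT.of_isClosed_subset (isClosed_tsupport g) hgT
  have hgd : ContDiff ℝ 1 g := by
    refine contDiff_iff_contDiffAt.mpr fun w => ?_
    by_cases hw : w ∈ Ω
    · have h1 : ContDiffAt ℝ 1 f w :=
        ((hf.contDiffOn hΩ (n := 1)).contDiffAt (hΩ.mem_nhds hw)).restrict_scalars ℝ
      exact (Complex.ofRealCLM.contDiff.comp hχc).contDiffAt.mul h1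
    · have h1 : g =ᶠ[𝓝 w] 0 := notMem_tsupport_iff_eventuallyEq.mp fun h => hw (hTΩ (hgT h))
      exact contDiffAt_const.congr_of_eventuallyEq h1
  set u : ℂ → ℂ := fun w => fderiv ℝ g w 1 + Complex.I * fderiv ℝ g w Complex.I with hu
  have huc : Continuous u := by
    have := hgd.continuous_fderiv one_ne_zero
    simp only [hu]
    fun_prop
  -- Near `L` the cutoff is `1`, so `g = f` is holomorphic there and the Cauchy-Riemann equations
  -- give `u = 0`.
  have hu0 : ∀ w ∈ L, u =ᶠ[𝓝 w] 0 := by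
    intro w hw
    have h1 : ∀ᶠ x in 𝓝 w, χ x = 1 := hχ1.filter_mono (nhds_le_nhdsSet hw)
    filter_upwards [h1.eventually_nhds, hΩ.mem_nhds (hLΩ hw)] with x hx hxΩ
    have h2 : g =ᶠ[𝓝 x] f := by
      filter_upwards [hx] with y hy
      simp [hg, hy]
    have h3 : fderiv ℝ g x = (fderiv ℂ f x).restrictScalars ℝ := by
      rw [h2.fderiv_eq]
      exact (hf.differentiableAt (hΩ.mem_nhds hxΩ)).fderiv_restrictScalars ℝ
    have h4 : fderiv ℂ f x Complex.I = Complex.I * fderiv ℂ f x 1 := by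
      conv_lhs => rw [← mul_one Complex.I, ← smul_eq_mul, map_smul, smul_eq_mul]
    simp only [hu, h3, ContinuousLinearMap.coe_restrictScalars', h4, Pi.zero_apply]
    rw [← mul_assoc, Complex.I_mul_I]
    ring
  -- The singularity `w = z` lies in `L`, where `u` vanishes locally. Hence `w ↦ u w / (w - ·)` is a
  -- continuous function with values in `C(K, ℂ)`.
  have hjoint : Continuous fun p : ℂ × K => u p.1 * (p.1 - p.2)⁻¹ := by
    refine continuous_iff_continuousAt.mpr fun ⟨w, z⟩ => ?_
    by_cases hw : w ∈ L
    · have h1 : (fun p : ℂ × K => u p.1 * (p.1 - p.2)⁻¹) =ᶠ[𝓝 (w, z)] fun _ => 0 := by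
        filter_upwards [continuousAt_fst.eventually (hu0 w hw)] with p hp
        rw [hp]
        simp
      exact continuousAt_const.congr h1.symm
    · have h1 : w - (z : ℂ) ≠ 0 := fun h => hw (sub_eq_zero.mp h ▸ hKL z.2)
      refine (huc.comp continuous_fst).continuousAt.mul (ContinuousAt.inv₀ ?_ h1)
      fun_prop
  let G : C(ℂ, C(K, ℂ)) := ContinuousMap.curry ⟨_, hjoint⟩
  have hGapp : ∀ w z, G w z = u w * (w - z)⁻¹ := fun w z => rfl
  have hGc : HasCompactSupport G := by
    refine hT.of_isClosed_subset (isClosed_tsupport _) (closure_minimal (fun w hw => ?_) hT.isClosed)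
    by_contra h
    refine hw (ContinuousMap.ext fun z => ?_)
    have : fderiv ℝ g w = 0 :=
      image_eq_zero_of_notMem_tsupport fun h' => h (hgT (tsupport_fderiv_subset ℝ h'))
    simp [hGapp, hu, this]
  have hGi : MeasureTheory.Integrable G := G.continuous.integrable_of_hasCompactSupport hGc
  have hGS : ∀ w, G w ∈ S := by
    intro w
    by_cases hw : w ∈ L
    · have : G w = 0 := ContinuousMap.ext fun z => by simp [hGapp, (hu0 w hw).eq_of_nhds]
      rw [this]
      exact S.zero_mem
    · let c : C(K, ℂ) := ⟨fun z => (w - z)⁻¹, by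
        refine Continuous.inv₀ (by fun_prop) fun z h => hw (sub_eq_zero.mp h ▸ hKL z.2)⟩
      have : G w = u w • c := ContinuousMap.ext fun z => rfl
      rw [this]
      exact S.smul_mem _ (hker w hw c fun z => rfl)
  have hmem := S.integral_mem_of_isClosed hS hGi hGS
  have hFe : F = (-(2 * Real.pi : ℂ))⁻¹ • ∫ w, G w := by
    ext z
    rw [ContinuousMap.smul_apply, ContinuousMap.integral_apply hGi]
    simp only [hGapp, ← div_eq_mul_inv, hu]
    rw [integral_dbar_div_sub hgd hgc]
    have h1 : χ z = 1 := (hχ1.filter_mono (nhds_le_nhdsSet (hKL z.2))).self_of_nhds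
    have h2 : (Real.pi : ℂ) ≠ 0 := by exact_mod_cast Real.pi_ne_zero
    simp only [hg, h1, hF, smul_eq_mul]
    field_simp
    simp
  rw [hFe]
  exact S.smul_mem _ hmem

/-! ### Logarithms and holes of compact sets -/

/-- A nowhere vanishing continuous function on the plane does not agree with `z ↦ z - a` on a
circle around `a`. -/
theorem exists_eq_zero_of_eqOn_sphere {F : ℂ → ℂ} (hF : Continuous F) (a : ℂ) {R : ℝ} (hR : 0 < R)
    (h : ∀ z ∈ Metric.sphere a R, F z = z - a) : ∃ z, F z = 0 := by
  by_contra! h0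
  have hsc : IsSimplyConnected (Set.univ : Set ℂ) := by
    have : ContractibleSpace (Set.univ : Set ℂ) :=
      (Homeomorph.Set.univ ℂ).contractibleSpace
    exact (inferInstance : SimplyConnectedSpace (Set.univ : Set ℂ))
  obtain ⟨g, hg, hge⟩ := Complex.exists_continuousOn_eqOn_exp_comp hsc isOpen_univ
    hF.continuousOn (by simpa using h0)
  rw [continuousOn_univ] at hg
  have hge' : ∀ z, Complex.exp (g z) = F z := fun z => hge (Set.mem_univ z)
  -- Up to the factor `2πi`, `k` compares the global logarithm of `F` with the explicit one along
  -- the circle. It is continuous and integer valued, hence constant, yet it drops by `1` over a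
  -- full turn.
  set k : ℝ → ℂ := fun t => (g (circleMap a R t) - t * Complex.I - Real.log R) /
    (2 * Real.pi * Complex.I) with hk
  have hpi : (2 * Real.pi * Complex.I : ℂ) ≠ 0 := Complex.two_pi_I_ne_zero
  have hkc : Continuous k := by
    have := hg.comp (continuous_circleMap a R)
    simp only [hk]
    fun_prop
  have hkint : ∀ t, ∃ n : ℤ, k t = n := by
    intro t
    have h1 : Complex.exp (g (circleMap a R t)) =
        Complex.exp (Real.log R + t * Complex.I) := by
      rw [hge', h _ (circleMap_mem_sphere a hR.le t), Complex.exp_add, ← Complex.ofReal_exp,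
        Real.exp_log hR, circleMap]
      ring
    obtain ⟨n, hn⟩ := Complex.exp_eq_exp_iff_exists_int.mp h1
    refine ⟨n, ?_⟩
    simp only [hk, hn]
    field_simp
    ring
  choose n hn using hkint
  have hnc : Continuous n := by
    rw [Int.isClosedEmbedding_coe_real.isEmbedding.continuous_iff]
    have : ((↑) ∘ n : ℝ → ℝ) = fun t => (k t).re := by
      funext t; simp [hn]
    rw [this]
    exact Complex.continuous_re.comp hkc
  have hconst : n 0 = n (2 * Real.pi) := PreconnectedSpace.constant inferInstance hnc
  have h2 : k 0 = k (2 * Real.pi) := by rw [hn, hn, hconst]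
  have hper : circleMap a R (2 * Real.pi) = circleMap a R 0 := by
    simpa using periodic_circleMap a R 0
  simp only [hk, hper] at h2
  rw [div_left_inj' hpi] at h2
  have : (2 * Real.pi * Complex.I : ℂ) = 0 := by
    push_cast at h2
    linear_combination h2
  exact hpi this

/-- A branch of `log (z - a)` on a simply connected open set that does not contain `a`. -/
theorem IsSimplyConnectedOpen.exists_exp_eq_sub {Ω : Set ℂ} (hΩ : IsSimplyConnectedOpen Ω) {a : ℂ}
    (ha : a ∉ Ω) : ∃ g : ℂ → ℂ, ContinuousOn g Ω ∧ ∀ z ∈ Ω, Complex.exp (g z) = z - a := by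
  have key : ∀ z ∈ Ω, ∃ f : ℂ → ℂ, ContinuousOn f (connectedComponentIn Ω z) ∧
      ∀ w ∈ connectedComponentIn Ω z, Complex.exp (f w) = w - a := by
    intro z hz
    obtain ⟨f, hf, hf'⟩ := Complex.exists_continuousOn_eqOn_exp_comp (hΩ.2 z hz)
      hΩ.1.connectedComponentIn (g := fun w => w - a) (by fun_prop) (by
        rintro ⟨w, hw, hw0⟩
        exact ha (sub_eq_zero.mp hw0 ▸ connectedComponentIn_subset _ _ hw))
    exact ⟨f, hf, fun w hw => hf' hw⟩
  -- The branch is chosen per component, not per point, so that points of one component share it.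
  have key2 : ∀ C : Set ℂ, ∃ f : ℂ → ℂ, (∃ z ∈ Ω, C = connectedComponentIn Ω z) →
      ContinuousOn f C ∧ ∀ w ∈ C, Complex.exp (f w) = w - a := by
    intro C
    by_cases h : ∃ z ∈ Ω, C = connectedComponentIn Ω z
    · obtain ⟨z, hz, rfl⟩ := h
      obtain ⟨f, hf⟩ := key z hz
      exact ⟨f, fun _ => hf⟩
    · exact ⟨0, fun h' => absurd h' h⟩
  choose f hf using key2
  refine ⟨fun z => f (connectedComponentIn Ω z) z, fun z hz => ?_, fun z hz => ?_⟩
  · have hmem : connectedComponentIn Ω z ∈ 𝓝 z :=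
      hΩ.1.connectedComponentIn.mem_nhds (mem_connectedComponentIn hz)
    have h1 := ((hf _ ⟨z, hz, rfl⟩).1.continuousAt hmem)
    refine ContinuousAt.continuousWithinAt (h1.congr ?_)
    filter_upwards [hmem] with w hw
    rw [connectedComponentIn_eq hw]
  · exact (hf _ ⟨z, hz, rfl⟩).2 z (mem_connectedComponentIn hz)

/-- The holes of a compact subset of a simply connected open set are contained in this set. -/
theorem IsSimplyConnectedOpen.subset_of_isCompact_union {Ω : Set ℂ} (hΩ : IsSimplyConnectedOpen Ω)
    {K V : Set ℂ} (hK : IsCompact K) (hKΩ : K ⊆ Ω) (hV : IsOpen V) (hVK : IsCompact (V ∪ K)) :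
    V ⊆ Ω := by
  classical
  intro a haV
  by_contra ha
  obtain ⟨g, hg, hge⟩ := hΩ.exists_exp_eq_sub ha
  obtain ⟨G, hG⟩ := ContinuousMap.exists_restrict_eq hK.isClosed
    ⟨K.domRestrict g, continuousOn_iff_continuous_domRestrict.mp (hg.mono hKΩ)⟩
  have hGK : ∀ z ∈ K, G z = g z := fun z hz => congr($hG ⟨z, hz⟩)
  -- The two pieces agree on the frontier of `V`, which lies in `K`. The glued function has no zero,
  -- because `a ∈ V`, but equals `z - a` on a large circle.
  have hFc : Continuous (V.piecewise (fun z => Complex.exp (G z)) fun z => z - a) := by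
    refine continuous_piecewise ?_ (by fun_prop) (by fun_prop)
    intro z hz
    have hzK : z ∈ K := by
      have h1 : z ∈ V ∪ K := hVK.isClosed.closure_subset_iff.mpr Set.subset_union_left hz.1
      exact h1.resolve_left fun h => (hV.frontier_eq ▸ hz).2 h
    show Complex.exp (G z) = z - a
    rw [hGK z hzK, hge z (hKΩ hzK)]
  obtain ⟨R, hR, hVR⟩ := (hVK.isBounded.subset Set.subset_union_left).subset_ball_lt 0 a
  obtain ⟨z, hz⟩ := exists_eq_zero_of_eqOn_sphere hFc a hR (by
    intro z hz
    rw [Set.piecewise_eq_of_notMem]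
    intro hzV
    exact (Metric.mem_ball.mp (hVR hzV)).ne (Metric.mem_sphere.mp hz))
  by_cases hzV : z ∈ V
  · rw [Set.piecewise_eq_of_mem _ _ _ hzV] at hz
    exact Complex.exp_ne_zero _ hz
  · rw [Set.piecewise_eq_of_notMem _ _ _ hzV] at hz
    exact hzV (sub_eq_zero.mp hz ▸ haV)

/-! ### Runge's theorem by pushing poles -/

/-- A closed subalgebra contains the Neumann series of each of its elements of norm less than
`1`. -/
theorem Subalgebra.exists_mul_one_sub_eq_one {R : Type*} [NormedCommRing R] [NormedAlgebra ℂ R]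
    [CompleteSpace R] [HasSummableGeomSeries R] (A : Subalgebra ℂ R) (hA : IsClosed (A : Set R))
    {x : R} (hx : x ∈ A) (hx1 : ‖x‖ < 1) : ∃ y ∈ A, y * (1 - x) = 1 := by
  refine ⟨∑' n : ℕ, x ^ n, ?_, geom_series_mul_neg x hx1⟩
  exact hA.mem_of_tendsto (summable_geometric_of_norm_lt_one hx1).hasSum
    (Eventually.of_forall fun s => A.sum_mem fun n _ => A.pow_mem hx n)

/-- On a compact subset of a simply connected open set, holomorphic functions lie in the uniform
closure of the polynomials. -/
theorem IsSimplyConnectedOpen.mem_closure_polynomialFunctions {Ω : Set ℂ}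
    (hΩ : IsSimplyConnectedOpen Ω) {K : Set ℂ} [CompactSpace K] (hKΩ : K ⊆ Ω) {f : ℂ → ℂ}
    (hf : DifferentiableOn ℂ f Ω) (F : C(K, ℂ)) (hF : ∀ z, F z = f z) :
    F ∈ (polynomialFunctions K).topologicalClosure := by
  set A := (polynomialFunctions K).topologicalClosure with hAdef
  have hA : IsClosed (A : Set C(K, ℂ)) := Subalgebra.isClosed_topologicalClosure _
  have hK : IsCompact K := isCompact_iff_compactSpace.mpr inferInstance
  have hsub : ∀ w ∉ K, ∀ z : K, w - (z : ℂ) ≠ 0 := fun w hw z h => hw (sub_eq_zero.mp h ▸ z.2)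
  have hker : ∀ w ∉ K, ∃ c : C(K, ℂ), ∀ z, c z = (w - z)⁻¹ := fun w hw =>
    ⟨⟨fun z => (w - z)⁻¹, Continuous.inv₀ (by fun_prop) (hsub w hw)⟩, fun z => rfl⟩
  -- `W` holds the poles whose kernel is a uniform limit of polynomials on `K`. It is open and
  -- closed relative to the complement of `K` and contains a neighbourhood of infinity.
  set W : Set ℂ := {w | w ∉ K ∧ ∃ c ∈ A, ∀ z : K, c z = (w - z)⁻¹} with hW
  have hWK : ∀ w ∈ W, w ∉ K := fun w hw => hw.1
  have hKcpt : K ⊆ Wᶜ := fun z hz hzW => hzW.1 hz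
  -- perturbation of the pole
  have hpert : ∀ w w' : ℂ, ∀ c ∈ A, w' ∉ K → w ∉ K → (∀ z : K, c z = (w - z)⁻¹) →
      ‖w - w'‖ * ‖c‖ < 1 → w' ∈ W := by
    intro w w' c hc hw' hw hcz hlt
    obtain ⟨y, hy, hy1⟩ := A.exists_mul_one_sub_eq_one hA (A.smul_mem hc (w - w'))
      (by rwa [norm_smul])
    refine ⟨hw', y * c, A.mul_mem hy hc, fun z => ?_⟩
    have h1 : y z * (1 - (w - w') * c z) = 1 := by simpa using congr($hy1 z)
    have h2 := hsub w hw z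
    have h3 := hsub w' hw' z
    rw [hcz] at h1
    rw [ContinuousMap.mul_apply, hcz]
    field_simp at h1 ⊢
    linear_combination h1
  have hnear : ∀ w ∉ K, ∃ r > 0, ∀ w' ∉ K, ‖w - w'‖ < r → (w ∈ W ↔ w' ∈ W) := by
    intro w hw
    obtain ⟨δ, hδ, hδK⟩ := Metric.isOpen_iff.mp hK.isClosed.isOpen_compl w hw
    -- Half the radius keeps both poles at distance at least `δ / 2` from `K`, so the perturbation
    -- works in both directions.
    have hbound : ∀ w', ‖w - w'‖ < δ / 2 → ∀ c : C(K, ℂ), (∀ z, c z = (w' - z)⁻¹) →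
        ‖c‖ ≤ 2 / δ := by
      intro w' hw' c hc
      refine (ContinuousMap.norm_le _ (by positivity)).mpr fun z => ?_
      rw [hc, norm_inv, ← inv_div]
      refine inv_anti₀ (by positivity) ?_
      have h1 : δ ≤ ‖w - z‖ := by
        by_contra! h
        refine hδK (a := (z : ℂ)) ?_ z.2
        rwa [Metric.mem_ball, dist_comm, dist_eq_norm]
      have h2 : ‖w - z‖ ≤ ‖w - w'‖ + ‖w' - z‖ := by
        simpa using norm_add_le (w - w') (w' - z)
      linarith
    have hsmall : ∀ t : ℂ, ‖t‖ < δ / 2 → ∀ c : C(K, ℂ), ‖c‖ ≤ 2 / δ → ‖t‖ * ‖c‖ < 1 := by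
      intro t ht c hc
      calc ‖t‖ * ‖c‖ ≤ ‖t‖ * (2 / δ) := by gcongr
        _ < (δ / 2) * (2 / δ) := by gcongr
        _ = 1 := by field_simp
    refine ⟨δ / 2, by positivity, fun w' hw' hlt => ⟨?_, ?_⟩⟩
    · rintro ⟨-, c, hc, hcz⟩
      exact hpert w w' c hc hw' hw hcz
        (hsmall _ hlt c (hbound w (by simpa using half_pos hδ) c hcz))
    · rintro ⟨-, c, hc, hcz⟩
      refine hpert w' w c hc hw hw' hcz ?_
      rw [norm_sub_rev]
      exact hsmall _ hlt c (hbound w' hlt c hcz)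
  have hWo : IsOpen W := by
    refine isOpen_iff_mem_nhds.mpr fun w hw => ?_
    obtain ⟨r, hr, h⟩ := hnear w hw.1
    filter_upwards [hK.isClosed.isOpen_compl.mem_nhds hw.1, Metric.ball_mem_nhds w hr] with w' h1 h2
    rw [Metric.mem_ball, dist_comm, dist_eq_norm] at h2
    exact (h w' h1 h2).mp hw
  have hVo : IsOpen (Wᶜ \ K) := by
    refine isOpen_iff_mem_nhds.mpr fun w hw => ?_
    obtain ⟨r, hr, h⟩ := hnear w hw.2
    filter_upwards [hK.isClosed.isOpen_compl.mem_nhds hw.2, Metric.ball_mem_nhds w hr] with w' h1 h2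
    rw [Metric.mem_ball, dist_comm, dist_eq_norm] at h2
    exact ⟨fun h' => hw.1 ((h w' h1 h2).mpr h'), h1⟩
  have hbdd : Bornology.IsBounded Wᶜ := by
    obtain ⟨R, hR, hKR⟩ := hK.isBounded.subset_ball_lt 0 0
    refine (Metric.isBounded_closedBall (x := (0 : ℂ)) (r := R)).subset fun w hw => ?_
    by_contra hwR
    rw [mem_closedBall_zero_iff, not_le] at hwR
    have hw0 : w ≠ 0 := norm_pos_iff.mp (hR.trans hwR)
    have hwK : w ∉ K := fun h => by
      have := hKR h
      rw [mem_ball_zero_iff] at this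
      linarith
    let x : C(K, ℂ) := ⟨fun z => z, continuous_subtype_val⟩
    have hx : x ∈ A := Subalgebra.le_topologicalClosure _
      ⟨Polynomial.X, trivial, ContinuousMap.ext fun z => by simp [x]⟩
    have hxR : ‖x‖ ≤ R := (ContinuousMap.norm_le _ hR.le).mpr fun z =>
      (mem_ball_zero_iff.mp (hKR z.2)).le
    -- For `‖w‖ > R`, the series of `1 / (w - z)` in powers of `z / w` converges uniformly on `K`.
    obtain ⟨y, hy, hy1⟩ := A.exists_mul_one_sub_eq_one hA (A.smul_mem hx w⁻¹) (by
      rw [norm_smul, norm_inv, inv_mul_lt_one₀ (by positivity)]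
      linarith)
    refine hw ⟨hwK, w⁻¹ • y, A.smul_mem hy _, fun z => ?_⟩
    have h1 : y z * (1 - w⁻¹ * z) = 1 := by simpa [x] using congr($hy1 z)
    have h2 := hsub w hwK z
    rw [ContinuousMap.smul_apply, smul_eq_mul]
    field_simp at h1 ⊢
    linear_combination h1
  have hLcpt : IsCompact Wᶜ := Metric.isCompact_of_isClosed_isBounded hWo.isClosed_compl hbdd
  have hLΩ : Wᶜ ⊆ Ω := by
    have h1 : Wᶜ \ K ∪ K = Wᶜ := Set.sdiff_union_of_subset hKcpt
    have h2 := hΩ.subset_of_isCompact_union hK hKΩ hVo (by rwa [h1])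
    rw [← h1]
    exact Set.union_subset h2 hKΩ
  refine mem_of_forall_inv_sub_mem hKcpt hLcpt hΩ.1 hLΩ hf (Subalgebra.toSubmodule A) hA ?_ F hF
  intro w hw c hc
  obtain ⟨-, c', hc', hcz⟩ := not_not.mp hw
  have : c = c' := ContinuousMap.ext fun z => by rw [hc, hcz]
  exact this ▸ hc'

/-- **Runge's theorem** on a simply connected open set. -/
theorem IsSimplyConnectedOpen.exists_polynomial_forall_norm_sub_lt {Ω : Set ℂ}
    (hΩ : IsSimplyConnectedOpen Ω) {K : Set ℂ} (hK : IsCompact K) (hKΩ : K ⊆ Ω) {f : ℂ → ℂ}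
    (hf : DifferentiableOn ℂ f Ω) {ε : ℝ} (hε : 0 < ε) :
    ∃ P : ℂ[X], ∀ z ∈ K, ‖P.eval z - f z‖ < ε := by
  have : CompactSpace K := isCompact_iff_compactSpace.mp hK
  have hmem := hΩ.mem_closure_polynomialFunctions hKΩ hf
    ⟨K.domRestrict f, continuousOn_iff_continuous_domRestrict.mp (hf.continuousOn.mono hKΩ)⟩
    fun z => rfl
  obtain ⟨b, ⟨P, -, rfl⟩, hlt⟩ := Metric.mem_closure_iff.mp hmem ε hε
  refine ⟨P, fun z hz => ?_⟩
  rw [← dist_eq_norm, dist_comm]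
  simpa using (ContinuousMap.dist_apply_le_dist (⟨z, hz⟩ : K)).trans_lt hlt

/-! ### Closed form of the Padé approximant -/

/-- The coefficients of the normalized denominator of the Padé approximant `[p/q]`, from the linear
system with the Hankel matrix. -/
noncomputable def padeDenominatorCoeff (a : ℕ → ℂ) (p q k : ℕ) : ℂ :=
  if k = 0 then 1
  else if h : q - k < q then
    ((hankelMatrix a p q)⁻¹.mulVec fun i => - a (p + 1 + i)) ⟨q - k, h⟩
  else 0

/-- The value of the normalized denominator of the Padé approximant `[p/q]`. -/
noncomputable def padeDenominator (a : ℕ → ℂ) (p q : ℕ) (w : ℂ) : ℂ :=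
  ∑ k ∈ Finset.range (q + 1), padeDenominatorCoeff a p q k * w ^ k

/-- The value of the numerator of the Padé approximant `[p/q]` that belongs to the normalized
denominator. -/
noncomputable def padeNumerator (a : ℕ → ℂ) (p q : ℕ) (w : ℂ) : ℂ :=
  ∑ v ∈ Finset.range (p + 1),
    (∑ j ∈ Finset.range (q + 1), padeDenominatorCoeff a p q j *
      extendCoefficients a ((v : ℤ) - j)) * w ^ v

/-- The Taylor conditions of index `p + 1, …, p + q` form the invertible Hankel system for the
coefficients of `D`; those of index at most `p` then give `N`. -/
theorem eval_eq_padeDenominator_and_padeNumerator {a : ℕ → ℂ} {p q : ℕ}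
    (h : HankelNondegenerate a p q) {N D : ℂ[X]} (hN : N.natDegree ≤ p) (hD : D.natDegree ≤ q)
    (h0 : D.coeff 0 = 1)
    (hT : ∀ v ≤ p + q, PowerSeries.coeff v ((N : PowerSeries ℂ) * (D : PowerSeries ℂ)⁻¹) = a v)
    (w : ℂ) : D.eval w = padeDenominator a p q w ∧ N.eval w = padeNumerator a p q w := by
  rw [coeff_mul_inv_eq_iff _ _ _ _ h0] at hT
  have hvec : (hankelMatrix a p q).mulVec (fun j => D.coeff (q - j)) =
      fun i : Fin q => - a (p + 1 + i) := by
    funext i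
    have hi := i.2
    have e := coeff_mul_mk_eq_hankel a p q D hD h0 i
    rw [← hT _ (by omega), Polynomial.coeff_eq_zero_of_natDegree_lt (by omega)] at e
    exact eq_neg_of_add_eq_zero_right e.symm
  have hvec' : (fun j : Fin q => D.coeff (q - j)) =
      (hankelMatrix a p q)⁻¹.mulVec fun i => - a (p + 1 + i) := by
    rw [← hvec, Matrix.mulVec_mulVec, Matrix.nonsing_inv_mul _ (isUnit_iff_ne_zero.mpr h),
      Matrix.one_mulVec]
  have hco : ∀ k < q + 1, D.coeff k = padeDenominatorCoeff a p q k := by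
    intro k hk
    rw [padeDenominatorCoeff]
    split_ifs with h1 h2
    · rw [h1, h0]
    · rw [← hvec']
      simp only
      congr 1
      omega
    · omega
  constructor
  · rw [Polynomial.eval_eq_sum_range' (Nat.lt_succ_of_le hD)]
    exact Finset.sum_congr rfl fun k hk => by rw [hco k (Finset.mem_range.mp hk)]
  · rw [Polynomial.eval_eq_sum_range' (Nat.lt_succ_of_le hN)]
    refine Finset.sum_congr rfl fun v hv => ?_
    rw [hT v (by have := Finset.mem_range.mp hv; omega), coeff_mul_mk_eq a q v D hD]
    congr 1
    exact Finset.sum_congr rfl fun k hk => by rw [hco k (Finset.mem_range.mp hk)]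

theorem isPadeApproximant_padeApproximant {a : ℕ → ℂ} {p q : ℕ} (h : HankelNondegenerate a p q) :
    IsPadeApproximant a p q (padeApproximant a p q) := by
  have hex := (existsUnique_isPadeApproximant a p q h).exists
  rw [padeApproximant, dif_pos hex]
  exact hex.choose_spec

/-- The reduced form of a Padé approximant is, up to a constant factor, the one given by the Hankel
system. -/
theorem exists_eval_denom_eval_num_eq {a : ℕ → ℂ} {p q : ℕ} (h : HankelNondegenerate a p q) :
    ∃ c : ℂ, c ≠ 0 ∧ ∀ w,
      padeDenominator a p q w = c * (padeApproximant a p q).denom.eval w ∧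
      padeNumerator a p q w = c * (padeApproximant a p q).num.eval w := by
  obtain ⟨N, D, hN, hD, h0, hR, hT⟩ := isPadeApproximant_padeApproximant h
  set R := padeApproximant a p q with hRdef
  have hD0 : D ≠ 0 := by rintro rfl; simp at h0
  obtain ⟨E, hE⟩ : R.denom ∣ D := by rw [hR]; exact RatFunc.denom_div_dvd _ _
  have hNE : N = R.num * E := by
    have h1 : N * R.denom = R.num * D := by
      have h2 := RatFunc.num_div_denom R
      rw [hR, div_eq_div_iff (RatFunc.algebraMap_ne_zero (RatFunc.denom_ne_zero _))
        (RatFunc.algebraMap_ne_zero hD0), ← hR, ← map_mul, ← map_mul] at h2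
      exact (RatFunc.algebraMap_injective ℂ h2).symm
    refine mul_right_cancel₀ (RatFunc.denom_ne_zero R) ?_
    rw [h1, hE]
    ring
  have hE0 : E ≠ 0 := by rintro rfl; simp [hE] at hD0
  have hd0 : R.denom.coeff 0 ≠ 0 := by
    intro h1
    rw [hE, Polynomial.mul_coeff_zero, h1, zero_mul] at h0
    exact zero_ne_one h0
  have hdeg : ∀ M : ℂ[X], M.natDegree ≤ (M * E).natDegree := by
    intro M
    by_cases hM : M = 0
    · simp [hM]
    · rw [Polynomial.natDegree_mul hM hE0]
      omega
  -- The reduced pair, scaled so that its denominator is `1` at the centre, still satisfies the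
  -- degree bounds and Taylor conditions, so the closed forms apply to it.
  refine ⟨(R.denom.coeff 0)⁻¹, inv_ne_zero hd0, fun w => ?_⟩
  have hco0 : (Polynomial.C (R.denom.coeff 0)⁻¹ * R.denom).coeff 0 = 1 := by
    simp [hd0]
  have key := eval_eq_padeDenominator_and_padeNumerator h
    (N := Polynomial.C (R.denom.coeff 0)⁻¹ * R.num)
    (D := Polynomial.C (R.denom.coeff 0)⁻¹ * R.denom)
    ((Polynomial.natDegree_C_mul_le _ _).trans ((hdeg _).trans (hNE ▸ hN)))
    ((Polynomial.natDegree_C_mul_le _ _).trans ((hdeg _).trans (hE ▸ hD))) hco0 (by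
      intro v hv
      rw [← hT v hv]
      congr 1
      have hc1 : PowerSeries.constantCoeff (D : PowerSeries ℂ) ≠ 0 := by simp [h0]
      have hc2 : PowerSeries.constantCoeff
          ((Polynomial.C (R.denom.coeff 0)⁻¹ * R.denom : ℂ[X]) : PowerSeries ℂ) ≠ 0 := by
        rw [Polynomial.constantCoeff_coe, hco0]
        exact one_ne_zero
      rw [PowerSeries.eq_mul_inv_iff_mul_eq hc1, mul_right_comm, eq_comm,
        PowerSeries.eq_mul_inv_iff_mul_eq hc2, ← Polynomial.coe_mul, ← Polynomial.coe_mul]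
      congr 1
      conv_lhs => rw [hNE]
      conv_rhs => rw [hE]
      ring) w
  simp only [Polynomial.eval_mul, Polynomial.eval_C] at key
  exact ⟨key.1.symm, key.2.symm⟩

/-- The reduced pair and the closed forms differ by a non-zero constant, so they have the same poles
and quotient. This replaces `RatFunc` by expressions continuous in the coefficients. -/
theorem padeError_lt_iff {Ω : Set ℂ} {f : HolomorphicFunctions Ω} {p q : ℕ} {ζ : ℂ}
    (h : MemD f p q ζ) (z : ℂ) {ε : ℝ≥0∞} :
    padeError f p q ζ z < ε ↔
      (padeDenominator (taylorCoefficient (extendZero f.1) ζ) p q (z - ζ) ≠ 0 ∧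
        ‖padeNumerator (taylorCoefficient (extendZero f.1) ζ) p q (z - ζ) /
          padeDenominator (taylorCoefficient (extendZero f.1) ζ) p q (z - ζ) -
            extendZero f.1 z‖ₑ < ε) := by
  obtain ⟨c, hc, hcw⟩ := exists_eval_denom_eval_num_eq h
  rw [(hcw _).1, (hcw _).2, mul_div_mul_left _ _ hc]
  simp only [padeError, RatFunc.eval, Polynomial.eval₂_id]
  split_ifs with h1
  · simp [h1]
  · simp [h1, hc]

/-! ### Continuous dependence on the coefficients -/

theorem continuous_extendCoefficients (i : ℤ) :
    Continuous fun a : ℕ → ℂ => extendCoefficients a i := by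
  unfold extendCoefficients
  split_ifs
  · exact continuous_const
  · exact continuous_apply _

theorem continuous_hankelMatrix (p q : ℕ) : Continuous fun a : ℕ → ℂ => hankelMatrix a p q :=
  continuous_matrix fun _ _ => continuous_extendCoefficients _

theorem isOpen_setOf_hankelNondegenerate (p q : ℕ) :
    IsOpen {a : ℕ → ℂ | HankelNondegenerate a p q} :=
  isOpen_ne.preimage (continuous_hankelMatrix p q).matrix_det

theorem continuousAt_padeDenominatorCoeff {a : ℕ → ℂ} {p q : ℕ} (h : HankelNondegenerate a p q)
    (k : ℕ) : ContinuousAt (fun a => padeDenominatorCoeff a p q k) a := by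
  unfold padeDenominatorCoeff
  split_ifs with h1 h2
  · exact continuousAt_const
  · have hH := continuous_hankelMatrix p q
    -- Cramer's rule: the inverse is the adjugate divided by the non-vanishing determinant.
    simp only [Matrix.inv_def, Ring.inverse_eq_inv', Matrix.mulVec, dotProduct, Matrix.smul_apply,
      smul_eq_mul]
    refine tendsto_finsetSum _ fun j _ => ?_
    refine ContinuousAt.mul (ContinuousAt.mul (hH.matrix_det.continuousAt.inv₀ h) ?_) ?_
    · exact (hH.matrix_adjugate.matrix_elem _ _).continuousAt
    · exact (continuous_apply _).neg.continuousAt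
  · exact continuousAt_const

theorem continuousAt_padeDenominator {a : ℕ → ℂ} {p q : ℕ} (h : HankelNondegenerate a p q) (w : ℂ) :
    ContinuousAt (fun x : (ℕ → ℂ) × ℂ => padeDenominator x.1 p q x.2) (a, w) := by
  refine tendsto_finsetSum _ fun k _ => ?_
  exact ContinuousAt.mul
    ((continuousAt_padeDenominatorCoeff h k).comp (f := Prod.fst) (x := (a, w)) continuousAt_fst)
    (continuous_snd.pow k).continuousAt

theorem continuousAt_padeNumerator {a : ℕ → ℂ} {p q : ℕ} (h : HankelNondegenerate a p q) (w : ℂ) :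
    ContinuousAt (fun x : (ℕ → ℂ) × ℂ => padeNumerator x.1 p q x.2) (a, w) := by
  refine tendsto_finsetSum _ fun v _ => ?_
  refine ContinuousAt.mul (tendsto_finsetSum _ fun k _ => ?_) (continuous_snd.pow v).continuousAt
  exact ContinuousAt.mul
    ((continuousAt_padeDenominatorCoeff h k).comp (f := Prod.fst) (x := (a, w)) continuousAt_fst)
    ((continuous_extendCoefficients _).comp continuous_fst).continuousAt

theorem Filter.Tendsto.eventually_padeQuotient_sub_lt {ι : Type*} {l : Filter ι} {α : ι → ℕ → ℂ}
    {w c : ι → ℂ} {a : ℕ → ℂ} {w₀ c₀ : ℂ} (ha : Tendsto α l (𝓝 a)) (hw : Tendsto w l (𝓝 w₀))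
    (hc : Tendsto c l (𝓝 c₀)) {p q : ℕ} (hH : HankelNondegenerate a p q) {ε : ℝ≥0∞}
    (hd : padeDenominator a p q w₀ ≠ 0)
    (hlt : ‖padeNumerator a p q w₀ / padeDenominator a p q w₀ - c₀‖ₑ < ε) :
    ∀ᶠ i in l, HankelNondegenerate (α i) p q ∧ padeDenominator (α i) p q (w i) ≠ 0 ∧
      ‖padeNumerator (α i) p q (w i) / padeDenominator (α i) p q (w i) - c i‖ₑ < ε := by
  have haw := ha.prodMk_nhds hw
  have h1 : Tendsto (fun x : (ℕ → ℂ) × ℂ => padeDenominator x.1 p q x.2) (𝓝 (a, w₀))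
      (𝓝 (padeDenominator a p q w₀)) := continuousAt_padeDenominator hH w₀
  have h2 : Tendsto (fun x : (ℕ → ℂ) × ℂ => padeNumerator x.1 p q x.2) (𝓝 (a, w₀))
      (𝓝 (padeNumerator a p q w₀)) := continuousAt_padeNumerator hH w₀
  have hden := h1.comp haw
  have hquot := ((((h2.comp haw).div hden hd).sub hc).enorm).eventually_lt_const hlt
  filter_upwards [ha.eventually ((isOpen_setOf_hankelNondegenerate p q).mem_nhds hH),
    hden.eventually_ne hd, hquot] with i h1 h2 h3
  exact ⟨h1, h2, h3⟩

/-! ### The space H(Ω) and its Taylor coefficients -/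

theorem extendZero_apply {Ω : Set ℂ} (f : Ω → ℂ) (z : Ω) : extendZero f z = f z :=
  Subtype.val_injective.extend_apply _ _ _

theorem extendZero_of_mem {Ω : Set ℂ} (f : Ω → ℂ) {z : ℂ} (hz : z ∈ Ω) :
    extendZero f z = f ⟨z, hz⟩ :=
  extendZero_apply f ⟨z, hz⟩

namespace HolomorphicFunctions

variable {Ω : Set ℂ}

/-- The restriction to `Ω` of a function that is holomorphic on `Ω`. -/
noncomputable def restrict (g : ℂ → ℂ) (hg : DifferentiableOn ℂ g Ω) : HolomorphicFunctions Ω :=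
  ⟨⟨Ω.domRestrict g, continuousOn_iff_continuous_domRestrict.mp hg.continuousOn⟩,
    hg.congr fun _ hz => extendZero_of_mem _ hz⟩

theorem extendZero_restrict (g : ℂ → ℂ) (hg : DifferentiableOn ℂ g Ω) {z : ℂ} (hz : z ∈ Ω) :
    extendZero (restrict g hg).1 z = g z :=
  extendZero_of_mem _ hz

theorem tendstoLocallyUniformlyOn_of_tendsto (hΩ : IsOpen Ω) {ι : Type*} {l : Filter ι}
    {F : ι → C(Ω, ℂ)} {f : C(Ω, ℂ)} (h : Tendsto F l (𝓝 f)) :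
    TendstoLocallyUniformlyOn (fun i => extendZero (F i)) (extendZero f) l Ω := by
  have := hΩ.locallyCompactSpace
  rw [tendstoLocallyUniformlyOn_iff_tendstoLocallyUniformly_comp_coe]
  have h1 := ContinuousMap.tendsto_iff_tendstoLocallyUniformly.mp h
  convert h1 using 1
  · funext i z
    exact extendZero_apply _ z
  · funext z
    exact extendZero_apply _ z

theorem isClosed_setOf_differentiableOn (hΩ : IsOpen Ω) :
    IsClosed {f : C(Ω, ℂ) | DifferentiableOn ℂ (extendZero f) Ω} := by
  refine isClosed_iff_forall_filter.mpr fun f l hl hle hlf => ?_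
  have h1 : Tendsto (id : C(Ω, ℂ) → C(Ω, ℂ)) l (𝓝 f) := hlf
  exact (tendstoLocallyUniformlyOn_of_tendsto hΩ h1).differentiableOn
    (le_principal_iff.mp hle) hΩ

/-- By Weierstrass, H(Ω) is closed in the complete space `C(Ω, ℂ)`, whose uniformity is countably
generated because `Ω` is locally compact and σ-compact. -/
theorem baireSpace (hΩ : IsOpen Ω) : BaireSpace (HolomorphicFunctions Ω) := by
  have := hΩ.locallyCompactSpace
  have : CompleteSpace (HolomorphicFunctions Ω) :=
    (isClosed_setOf_differentiableOn hΩ).completeSpace_coe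
  have : (uniformity (HolomorphicFunctions Ω)).IsCountablyGenerated :=
    Filter.comap.isCountablyGenerated _ _
  have : TopologicalSpace.IsCompletelyPseudoMetrizableSpace (HolomorphicFunctions Ω) :=
    inferInstance
  infer_instance

theorem differentiableOn_iteratedDeriv (hΩ : IsOpen Ω) (f : HolomorphicFunctions Ω) (v : ℕ) :
    DifferentiableOn ℂ (iteratedDeriv v (extendZero f.1)) Ω := by
  induction v with
  | zero => simpa using f.2
  | succ v ih =>
    rw [iteratedDeriv_succ]
    exact ih.deriv hΩ

theorem tendstoLocallyUniformlyOn_iteratedDeriv (hΩ : IsOpen Ω) {ι : Type*} {l : Filter ι}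
    {F : ι → HolomorphicFunctions Ω} {f : HolomorphicFunctions Ω} (h : Tendsto F l (𝓝 f)) (v : ℕ) :
    TendstoLocallyUniformlyOn (fun i => iteratedDeriv v (extendZero (F i).1))
      (iteratedDeriv v (extendZero f.1)) l Ω := by
  induction v with
  | zero =>
    simpa using tendstoLocallyUniformlyOn_of_tendsto hΩ ((continuous_subtype_val.tendsto f).comp h)
  | succ v ih =>
    simp only [iteratedDeriv_succ]
    exact ih.deriv (Eventually.of_forall fun i => differentiableOn_iteratedDeriv hΩ (F i) v) hΩ

theorem continuousAt_extendZero (hΩ : IsOpen Ω) (f : HolomorphicFunctions Ω) {z : ℂ}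
    (hz : z ∈ Ω) :
    ContinuousAt (fun x : HolomorphicFunctions Ω × ℂ => extendZero x.1.1 x.2) (f, z) := by
  have h1 : Tendsto (fun x : HolomorphicFunctions Ω × ℂ => x.1) (𝓝 (f, z)) (𝓝 f) :=
    continuousAt_fst
  refine (tendstoLocallyUniformlyOn_of_tendsto hΩ
    ((continuous_subtype_val.tendsto f).comp h1)).tendsto_comp (f.2.continuousOn z hz) hz ?_
  rw [hΩ.nhdsWithin_eq hz]
  exact continuousAt_snd

/-- Locally uniform convergence passes to all derivatives. The product topology on sequences
suffices, as a Padé approximant involves finitely many coefficients. -/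
theorem continuousAt_taylorCoefficient (hΩ : IsOpen Ω) (f : HolomorphicFunctions Ω) {ζ : ℂ}
    (hζ : ζ ∈ Ω) :
    ContinuousAt (fun x : HolomorphicFunctions Ω × ℂ => taylorCoefficient (extendZero x.1.1) x.2)
      (f, ζ) := by
  refine continuousAt_pi.mpr fun v => ?_
  refine ContinuousAt.div_const ?_ _
  have h1 : Tendsto (fun x : HolomorphicFunctions Ω × ℂ => x.1) (𝓝 (f, ζ)) (𝓝 f) :=
    continuousAt_fst
  have h2 := tendstoLocallyUniformlyOn_iteratedDeriv hΩ h1 v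
  refine h2.tendsto_comp ?_ hζ ?_
  · exact (differentiableOn_iteratedDeriv hΩ f v).continuousOn ζ hζ
  · rw [hΩ.nhdsWithin_eq hζ]
    exact continuousAt_snd

end HolomorphicFunctions

/-! ### Polynomials as their own Padé approximants -/

theorem Polynomial.taylorCoefficient_eval (Q : ℂ[X]) (ζ : ℂ) (v : ℕ) :
    taylorCoefficient (fun z => Q.eval z) ζ v = (Polynomial.taylor ζ Q).coeff v := by
  have h1 : iteratedDeriv v (fun z => Q.eval z) = fun z => (Polynomial.derivative^[v] Q).eval z := by
    induction v with
    | zero => simp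
    | succ v ih =>
      rw [iteratedDeriv_succ, ih, Function.iterate_succ_apply']
      funext z
      exact Polynomial.deriv _
  rw [taylorCoefficient, h1, Polynomial.taylor_coeff, ← Polynomial.factorial_smul_hasseDeriv]
  have : (v ! : ℂ) ≠ 0 := by exact_mod_cast v.factorial_ne_zero
  simp [this]

theorem taylorCoefficient_congr {f g : ℂ → ℂ} {ζ : ℂ} (h : f =ᶠ[𝓝 ζ] g) :
    taylorCoefficient f ζ = taylorCoefficient g ζ := by
  funext v
  rw [taylorCoefficient, taylorCoefficient, h.iteratedDeriv_eq]

/-- The Hankel determinant does not vanish if `a_p` is the last non-zero coefficient. -/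
theorem hankelNondegenerate_of_forall_gt {a : ℕ → ℂ} {p : ℕ} (hp : a p ≠ 0)
    (h : ∀ v > p, a v = 0) (q : ℕ) : HankelNondegenerate a p q := by
  -- Reversing the columns gives a Toeplitz matrix, upper triangular with diagonal `a p`.
  have hent : ∀ i j : Fin q, (hankelMatrix a p q).submatrix id Fin.revPerm i j =
      extendCoefficients a ((p : ℤ) + i - j) := by
    intro i j
    have hj := j.2
    simp only [hankelMatrix, Matrix.submatrix_apply, Matrix.of_apply, id, Fin.revPerm_apply,
      Fin.val_rev]
    congr 1
    omega
  have htri : ((hankelMatrix a p q).submatrix id Fin.revPerm).IsUpperTriangular := by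
    intro i j hij
    have hij' : (j : ℕ) < i := hij
    rw [hent, extendCoefficients, if_neg (by omega), h _ (by omega)]
  have hdet := Matrix.det_of_isUpperTriangular htri
  rw [Matrix.det_permute'] at hdet
  intro h0
  rw [h0, mul_zero] at hdet
  refine Finset.prod_ne_zero_iff.mpr (fun i _ => ?_) hdet.symm
  rw [hent, extendCoefficients, if_neg (by omega)]
  simpa using hp

/-! ### The Baire category argument -/

/-- The functions whose Padé approximant `[p/q]` exists at all centres in `K` and is closer than `ε`
on `K`. -/
def padeCloseFunctions (Ω K : Set ℂ) (ε : ℝ≥0∞) (p q : ℕ) : Set (HolomorphicFunctions Ω) :=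
  {f | ∀ ζ ∈ K, MemD f p q ζ ∧ ∀ z ∈ K, padeError f p q ζ z < ε}

/-- The conditions are open jointly in function, centre and point; the tube lemma over the compact
set `K × K` gives one neighbourhood of `f` for all centres and points. -/
theorem isOpen_padeCloseFunctions {Ω K : Set ℂ} (hΩ : IsOpen Ω) (hK : IsCompact K) (hKΩ : K ⊆ Ω)
    (ε : ℝ≥0∞) (p q : ℕ) : IsOpen (padeCloseFunctions Ω K ε p q) := by
  have hset : padeCloseFunctions Ω K ε p q =
      {f | ∀ x ∈ K ×ˢ K, MemD f p q x.1 ∧ padeError f p q x.1 x.2 < ε} := by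
    ext f
    constructor
    · rintro h ⟨ζ, z⟩ ⟨hζ, hz⟩
      exact ⟨(h ζ hζ).1, (h ζ hζ).2 z hz⟩
    · intro h ζ hζ
      exact ⟨(h (ζ, ζ) ⟨hζ, hζ⟩).1, fun z hz => (h (ζ, z) ⟨hζ, hz⟩).2⟩
  rw [hset, isOpen_iff_eventually]
  intro f hf
  refine (hK.prod hK).eventually_forall_of_forall_eventually
    (P := fun (f : HolomorphicFunctions Ω) x => MemD f p q x.1 ∧ padeError f p q x.1 x.2 < ε) ?_
  rintro ⟨ζ, z⟩ hx
  obtain ⟨hD, hlt⟩ := hf _ hx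
  obtain ⟨hζ, hz⟩ : ζ ∈ Ω ∧ z ∈ Ω := ⟨hKΩ hx.1, hKΩ hx.2⟩
  have hfst : Tendsto (fun y : HolomorphicFunctions Ω × ℂ × ℂ => (y.1, y.2.1)) (𝓝 (f, ζ, z))
      (𝓝 (f, ζ)) := Continuous.tendsto (by fun_prop) (f, ζ, z)
  have hsnd : Tendsto (fun y : HolomorphicFunctions Ω × ℂ × ℂ => (y.1, y.2.2)) (𝓝 (f, ζ, z))
      (𝓝 (f, z)) := Continuous.tendsto (by fun_prop) (f, ζ, z)
  have hw : Tendsto (fun y : HolomorphicFunctions Ω × ℂ × ℂ => y.2.2 - y.2.1) (𝓝 (f, ζ, z))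
      (𝓝 (z - ζ)) := Continuous.tendsto (by fun_prop) (f, ζ, z)
  have h1 : Tendsto (fun x : HolomorphicFunctions Ω × ℂ => taylorCoefficient (extendZero x.1.1) x.2)
      (𝓝 (f, ζ)) (𝓝 (taylorCoefficient (extendZero f.1) ζ)) :=
    HolomorphicFunctions.continuousAt_taylorCoefficient hΩ f hζ
  have h2 : Tendsto (fun x : HolomorphicFunctions Ω × ℂ => extendZero x.1.1 x.2)
      (𝓝 (f, z)) (𝓝 (extendZero f.1 z)) :=
    HolomorphicFunctions.continuousAt_extendZero hΩ f hz
  have ha := h1.comp hfst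
  have hval := h2.comp hsnd
  obtain ⟨hd0, hlt'⟩ := (padeError_lt_iff hD z).mp hlt
  filter_upwards [ha.eventually_padeQuotient_sub_lt hw hval hD hd0 hlt'] with y hy
  exact ⟨hy.1, (padeError_lt_iff hy.1 _).mpr hy.2⟩

/-- A polynomial of exact degree `p` is its own Padé approximant `[p/q]` at every centre. -/
theorem restrict_eval_mem_padeCloseFunctions {Ω K : Set ℂ} (hΩ : IsOpen Ω) (hKΩ : K ⊆ Ω) {Q : ℂ[X]}
    (hQ : Q ≠ 0) {ε : ℝ≥0∞} (hε : 0 < ε) (q : ℕ) :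
    HolomorphicFunctions.restrict (fun z => Q.eval z) Q.differentiable.differentiableOn ∈
      padeCloseFunctions Ω K ε Q.natDegree q := by
  intro ζ hζ
  have ha : taylorCoefficient (extendZero (HolomorphicFunctions.restrict (Ω := Ω)
      (fun z => Q.eval z) Q.differentiable.differentiableOn).1) ζ =
      fun v => (Polynomial.taylor ζ Q).coeff v := by
    rw [taylorCoefficient_congr (g := fun z => Q.eval z)]
    · funext v
      exact Polynomial.taylorCoefficient_eval Q ζ v
    · filter_upwards [hΩ.mem_nhds (hKΩ hζ)] with z hz
      exact HolomorphicFunctions.extendZero_restrict _ _ hz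
  have hdeg : (Polynomial.taylor ζ Q).natDegree = Q.natDegree := Polynomial.natDegree_taylor Q ζ
  have hH : HankelNondegenerate (fun v => (Polynomial.taylor ζ Q).coeff v) Q.natDegree q := by
    refine hankelNondegenerate_of_forall_gt ?_ (fun v hv => ?_) q
    · rw [← hdeg, Polynomial.coeff_natDegree, Polynomial.leadingCoeff_taylor]
      exact Polynomial.leadingCoeff_ne_zero.mpr hQ
    · exact Polynomial.coeff_eq_zero_of_natDegree_lt (hdeg.trans_lt hv)
  have hP : IsPadeApproximant (fun v => (Polynomial.taylor ζ Q).coeff v) Q.natDegree q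
      (algebraMap ℂ[X] (RatFunc ℂ) (Polynomial.taylor ζ Q)) :=
    ⟨Polynomial.taylor ζ Q, 1, hdeg.le, by simp, by simp, by simp, fun v _ => by simp⟩
  refine ⟨by rwa [MemD, ha], fun z hz => ?_⟩
  rw [padeError, ha, (existsUnique_isPadeApproximant _ _ _ hH).unique
    (isPadeApproximant_padeApproximant hH) hP,
    HolomorphicFunctions.extendZero_restrict _ _ (hKΩ hz)]
  simpa [RatFunc.eval, Polynomial.eval₂_id, Polynomial.taylor_eval_sub] using hε

theorem dense_iUnion_padeCloseFunctions {Ω : Set ℂ} (hΩ : IsSimplyConnectedOpen Ω)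
    {F : Set (ℕ × ℕ)} (hF : ∃ u : ℕ → ℕ × ℕ, (∀ n, u n ∈ F) ∧ Tendsto (fun n => (u n).1) atTop atTop)
    {K : Set ℂ} (hKΩ : K ⊆ Ω) {ε : ℝ≥0∞} (hε : 0 < ε) :
    Dense (⋃ x ∈ F, padeCloseFunctions Ω K ε x.1 x.2) := by
  intro f
  have := hΩ.1.locallyCompactSpace
  have happrox : ∀ (L : Set Ω) (δ : ℝ), IsCompact L → 0 < δ →
      ∃ g ∈ ⋃ x ∈ F, padeCloseFunctions Ω K ε x.1 x.2, ∀ z ∈ L, ‖g.1 z - f.1 z‖ < δ := by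
    intro L δ hL hδ
    obtain ⟨P, hP⟩ := hΩ.exists_polynomial_forall_norm_sub_lt (hL.image continuous_subtype_val)
      (by rintro _ ⟨z, -, rfl⟩; exact z.2) f.2 (half_pos hδ)
    obtain ⟨u, huF, hu⟩ := hF
    -- The strict inequality makes the added monomial the leading term, whatever `P` is.
    obtain ⟨n, hn⟩ := (hu.eventually_gt_atTop P.natDegree).exists
    obtain ⟨M, hM⟩ := hL.exists_bound_of_continuousOn
      (f := fun z : Ω => (z : ℂ) ^ (u n).1) (by fun_prop)
    -- The monomial then costs at most `δ / 2` on `L`, the other half being spent on `P`.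
    set d : ℝ := δ / (2 * (|M| + 1)) with hd
    have hd0 : 0 < d := by positivity
    have hdeg : (P + Polynomial.monomial (u n).1 (d : ℂ)).natDegree = (u n).1 := by
      rw [Polynomial.natDegree_add_eq_right_of_natDegree_lt] <;>
      rw [Polynomial.natDegree_monomial_eq _ (by exact_mod_cast hd0.ne')]
      exact hn
    have hQ0 : P + Polynomial.monomial (u n).1 (d : ℂ) ≠ 0 := by
      intro h0
      rw [h0, Polynomial.natDegree_zero] at hdeg
      omega
    refine ⟨HolomorphicFunctions.restrict
      (fun z => (P + Polynomial.monomial (u n).1 (d : ℂ)).eval z)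
      (Polynomial.differentiable _).differentiableOn, Set.mem_biUnion (huF n) ?_, ?_⟩
    · have := restrict_eval_mem_padeCloseFunctions hΩ.1 hKΩ hQ0 hε (u n).2
      rwa [hdeg] at this
    · intro z hz
      rw [← extendZero_apply (HolomorphicFunctions.restrict _ _).1, ← extendZero_apply f.1,
        HolomorphicFunctions.extendZero_restrict _ _ z.2, Polynomial.eval_add,
        Polynomial.eval_monomial, add_sub_right_comm]
      refine (norm_add_le _ _).trans_lt ?_
      have h1 := hP z ⟨z, hz, rfl⟩
      have h2 : ‖(d : ℂ) * (z : ℂ) ^ (u n).1‖ ≤ δ / 2 := by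
        rw [norm_mul, Complex.norm_real, Real.norm_of_nonneg hd0.le]
        calc d * ‖(z : ℂ) ^ (u n).1‖ ≤ d * (|M| + 1) := by
              gcongr
              linarith [hM z hz, le_abs_self M]
          _ = δ / 2 := by rw [hd]; field_simp
      linarith
  let E : CompactExhaustion Ω := CompactExhaustion.choice Ω
  have hseq : ∀ n : ℕ, ∃ g ∈ ⋃ x ∈ F, padeCloseFunctions Ω K ε x.1 x.2,
      ∀ z ∈ E n, ‖g.1 z - f.1 z‖ < 1 / ((n : ℝ) + 1) :=
    fun n => happrox _ _ (E.isCompact n) Nat.one_div_pos_of_nat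
  choose g hg hgE using hseq
  refine mem_closure_of_tendsto (f := g) (b := atTop) ?_ (Eventually.of_forall hg)
  rw [tendsto_subtype_rng, ContinuousMap.tendsto_iff_forall_isCompact_tendstoUniformlyOn]
  intro L hL
  obtain ⟨m, hm⟩ := E.exists_superset_of_isCompact hL
  rw [Metric.tendstoUniformlyOn_iff]
  intro δ hδ
  filter_upwards [eventually_ge_atTop m,
    (tendsto_one_div_add_atTop_nhds_zero_nat (𝕜 := ℝ)).eventually_lt_const hδ] with n hn hnδ z hz
  rw [dist_comm, dist_eq_norm]
  exact (hgE n z (E.subset hn (hm hz))).trans hnδ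

/-- Padé approximability is a countable intersection of conditions on an exhaustion of `Ω`. -/
theorem padeApproximableFunctions_eq_iInter {Ω : Set ℂ} (F : Set (ℕ × ℕ)) (E : CompactExhaustion Ω) :
    padeApproximableFunctions Ω F =
      ⋂ m : ℕ, ⋃ x ∈ F,
        padeCloseFunctions Ω (Subtype.val '' E m) ((m : ℝ≥0∞) + 1)⁻¹ x.1 x.2 := by
  ext f
  have hpos : ∀ m : ℕ, (0 : ℝ≥0∞) < ((m : ℝ≥0∞) + 1)⁻¹ := fun m =>
    ENNReal.inv_pos.mpr (by finiteness)
  simp only [Set.mem_iInter, Set.mem_iUnion, exists_prop]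
  constructor
  · rintro ⟨u, huF, hu⟩ m
    obtain ⟨⟨n₀, hn₀⟩, hlim⟩ := hu (Subtype.val '' E m)
      ((E.isCompact m).image continuous_subtype_val) (by rintro _ ⟨z, -, rfl⟩; exact z.2)
    obtain ⟨n, hn, hlt⟩ :=
      ((eventually_ge_atTop n₀).and (hlim.eventually_lt_const (hpos m))).exists
    refine ⟨u n, huF n, fun ζ hζ => ⟨hn₀ n hn ζ hζ, fun z hz => lt_of_le_of_lt ?_ hlt⟩⟩
    exact (le_iSup₂ (f := fun z _ => padeError f (u n).1 (u n).2 ζ z) z hz).trans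
      (le_iSup₂ (f := fun ζ _ => ⨆ z ∈ Subtype.val '' E m, padeError f (u n).1 (u n).2 ζ z) ζ hζ)
  · intro h
    -- One pair per index `m`, for `E m` and tolerance `1 / (m + 1)`. This single sequence serves
    -- every `K`, since `K` lies in `E n` for all large `n`.
    choose u huF hu using h
    refine ⟨u, huF, fun K hK hKΩ => ?_⟩
    obtain ⟨m, hm⟩ := E.exists_superset_of_isCompact
      (Topology.IsInducing.subtypeVal.isCompact_preimage' hK (by simpa using hKΩ))
    have hKE : ∀ n ≥ m, ∀ z ∈ K, z ∈ Subtype.val '' E n := fun n hn z hz =>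
      ⟨⟨z, hKΩ hz⟩, E.subset hn (hm hz), rfl⟩
    refine ⟨⟨m, fun n hn ζ hζ => (hu n ζ (hKE n hn ζ hζ)).1⟩, ?_⟩
    have h0 : Tendsto (fun n : ℕ => ((n : ℝ≥0∞) + 1)⁻¹) atTop (𝓝 0) := by
      have := (tendsto_add_atTop_iff_nat 1).mpr ENNReal.tendsto_inv_nat_nhds_zero
      simpa using this
    refine tendsto_of_tendsto_of_tendsto_of_le_of_le' tendsto_const_nhds h0
      (Eventually.of_forall fun _ => zero_le) ?_
    filter_upwards [eventually_ge_atTop m] with n hn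
    exact iSup₂_le fun ζ hζ => iSup₂_le fun z hz =>
      ((hu n ζ (hKE n hn ζ hζ)).2 z (hKE n hn z hz)).le

theorem theorem3p7 (Ω : Set ℂ) (hΩ : IsSimplyConnectedOpen Ω) (F : Set (ℕ × ℕ))
    (hF : ∃ u : ℕ → ℕ × ℕ, (∀ n, u n ∈ F) ∧ Tendsto (fun n => (u n).1) atTop atTop) :
    (∃ f : HolomorphicFunctions Ω, f ∈ padeApproximableFunctions Ω F) ∧
      IsGδ (padeApproximableFunctions Ω F) ∧ Dense (padeApproximableFunctions Ω F) := by
  have := hΩ.1.locallyCompactSpace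
  have := HolomorphicFunctions.baireSpace hΩ.1
  let E : CompactExhaustion Ω := CompactExhaustion.choice Ω
  have hE : ∀ m, Subtype.val '' E m ⊆ Ω := by
    rintro m _ ⟨z, -, rfl⟩
    exact z.2
  have hopen : ∀ m : ℕ, IsOpen (⋃ x ∈ F,
      padeCloseFunctions Ω (Subtype.val '' E m) ((m : ℝ≥0∞) + 1)⁻¹ x.1 x.2) := fun m =>
    isOpen_biUnion fun x _ => isOpen_padeCloseFunctions hΩ.1
      ((E.isCompact m).image continuous_subtype_val) (hE m) _ _ _
  have hdense : Dense (padeApproximableFunctions Ω F) := by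
    rw [padeApproximableFunctions_eq_iInter F E]
    exact dense_iInter_of_isOpen_nat hopen fun m => dense_iUnion_padeCloseFunctions hΩ hF (hE m)
      (ENNReal.inv_pos.mpr (by finiteness))
  have : Nonempty (HolomorphicFunctions Ω) :=
    ⟨HolomorphicFunctions.restrict 0 (differentiableOn_const 0)⟩
  refine ⟨hdense.nonempty, ?_, hdense⟩
  rw [padeApproximableFunctions_eq_iInter F E]
  exact .iInter fun m => (hopen m).isGδ
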